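/- Let $n\ge 1$ and let $\sigma=(p_1,\dots,p_n)\in\mathbb{R}^n$ with $p_1>p_2=\cdots=p_n$. Let $\mathrm{Her}(\mathbb{C}^n)$ be the real vector space of Hermitian $n\times n$ complex matrices, and let $\mathcal{D}(\sigma)\subset\mathrm{Her}(\mathbb{C}^n)$ be the set of those Hermitian matrices whose eigenvalues, listed with multiplicity, are $p_1,\dots,p_n$ (equivalently, the matrices $U\,\mathrm{diag}(p_1,\dots,p_n)\,U^{-1}$ with $U\in U(n)$). Then $\mathcal{D}(\sigma)$ is an embedded smooth submanifold of $\mathrm{Her}(\mathbb{C}^n)$ (that is, the subspace topology of $\mathcal{D}(\sigma)$ carries a smooth structure for which the inclusion is a smooth embedding), and with any such structure it is diffeomorphic, as a real smooth manifold, to the complex projective space $\mathbb{C}P^{n-1}$. -/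

import Mathlib

open scoped Manifold ContDiff Topology

/-! ### Complex projective space as a smooth manifold -/

/-- Complex projective space `ℂP^m`: the space of complex lines through `0` in `ℂ^(m+1)`. -/
def CP (m : ℕ) : Type := Projectivization ℂ (Fin (m + 1) → ℂ)

namespace CP

variable {m : ℕ}

/-- The point `[v]` of `ℂP^m` with homogeneous coordinates `v ≠ 0`. -/
noncomputable def mk (v : {v : Fin (m + 1) → ℂ // v ≠ 0}) : CP m := Projectivization.mk ℂ v.1 v.2

/-- The quotient topology of `ℂ^(m+1) ∖ {0} → ℂP^m`. -/
noncomputable instance : TopologicalSpace (CP m) := TopologicalSpace.coinduced mk inferInstance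

theorem isQuotientMap_mk : Topology.IsQuotientMap (mk : {v : Fin (m + 1) → ℂ // v ≠ 0} → CP m) :=
  ⟨⟨rfl⟩, fun x => Projectivization.ind (fun v hv => ⟨⟨v, hv⟩, rfl⟩) x⟩

/-- The `i`-th affine coordinates `[v] ↦ (v_j / v_i)_{j ≠ i}`. -/
noncomputable def toAffine (i : Fin (m + 1)) (x : CP m) : Fin m → ℂ :=
  Projectivization.lift (fun (v : {v : Fin (m + 1) → ℂ // v ≠ 0}) j => v.1 (i.succAbove j) / v.1 i)
    (by
      rintro a b t h
      have ht : t ≠ 0 := by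
        rintro rfl
        exact a.2 (by simpa using h)
      funext j
      simp [h, mul_div_mul_left _ _ ht]) x

/-- The point of `ℂP^m` with `i`-th homogeneous coordinate `1` and the others given by `z`. -/
noncomputable def ofAffine (i : Fin (m + 1)) (z : Fin m → ℂ) : CP m :=
  mk ⟨i.insertNth 1 z, fun h => one_ne_zero (α := ℂ) (by simpa using congrFun h i)⟩

/-- The domain `{[v] | v_i ≠ 0}` of the `i`-th affine coordinates. -/
def affineSet (i : Fin (m + 1)) : Set (CP m) := {x | ∃ v, v.1 i ≠ 0 ∧ mk v = x}

theorem mk_mem_affineSet (i : Fin (m + 1)) (v : {v : Fin (m + 1) → ℂ // v ≠ 0}) :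
    mk v ∈ affineSet i ↔ v.1 i ≠ 0 := by
  constructor
  · rintro ⟨w, hw, h⟩
    obtain ⟨a, ha⟩ := (Projectivization.mk_eq_mk_iff' ℂ _ _ w.2 v.2).1 h
    intro hv
    apply hw
    rw [← ha]
    simp [hv]
  · exact fun h => ⟨v, h, rfl⟩

theorem isOpen_affineSet (i : Fin (m + 1)) : IsOpen (affineSet (m := m) i) := by
  rw [← isQuotientMap_mk.isOpen_preimage]
  have : mk ⁻¹' affineSet i = {v : {v : Fin (m + 1) → ℂ // v ≠ 0} | v.1 i ≠ 0} := by
    ext v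
    exact mk_mem_affineSet i v
  rw [this]
  exact isOpen_ne_fun ((continuous_apply i).comp continuous_subtype_val) continuous_const

/-- The `i`-th affine chart of `ℂP^m`. -/
noncomputable def affineChart (i : Fin (m + 1)) : OpenPartialHomeomorph (CP m) (Fin m → ℂ) where
  toFun := toAffine i
  invFun := ofAffine i
  source := affineSet i
  target := Set.univ
  map_source' _ _ := Set.mem_univ _
  map_target' z _ := (mk_mem_affineSet i _).2 (by simp)
  left_inv' := by
    rintro _ ⟨v, hv, rfl⟩
    refine (Projectivization.mk_eq_mk_iff' ℂ _ _ _ v.2).2 ⟨(v.1 i)⁻¹, ?_⟩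
    funext k
    refine i.succAboveCases ?_ (fun j => ?_) k
    · simp [hv]
    · simp [toAffine, mk, div_eq_inv_mul]
  right_inv' z _ := by
    funext j
    simp [toAffine, ofAffine, mk]
  open_source := isOpen_affineSet i
  open_target := isOpen_univ
  continuousOn_toFun := by
    rw [isQuotientMap_mk.continuousOn_isOpen_iff (isOpen_affineSet i)]
    refine continuousOn_pi.2 fun j => ?_
    refine ContinuousOn.div (f := fun v : {v : Fin (m + 1) → ℂ // v ≠ 0} => v.1 (i.succAbove j))
      (g := fun v => v.1 i) ((continuous_apply _).comp continuous_subtype_val).continuousOn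
      ((continuous_apply i).comp continuous_subtype_val).continuousOn fun v hv => ?_
    exact (mk_mem_affineSet i v).1 hv
  continuousOn_invFun := by
    refine Continuous.continuousOn (isQuotientMap_mk.continuous.comp ?_)
    refine Continuous.subtype_mk (continuous_pi fun k => ?_) _
    refine i.succAboveCases ?_ (fun j => ?_) k
    · simpa using continuous_const
    · simpa using continuous_apply j

theorem exists_mem_affineSet (x : CP m) : ∃ i, x ∈ affineSet i := by
  obtain ⟨v, rfl⟩ := isQuotientMap_mk.surjective x
  obtain ⟨i, hi⟩ := Function.ne_iff.1 v.2
  exact ⟨i, v, hi, rfl⟩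

/-- The standard atlas of `ℂP^m`, consisting of the `m + 1` affine charts. -/
noncomputable instance : ChartedSpace (Fin m → ℂ) (CP m) where
  atlas := Set.range affineChart
  chartAt x := affineChart (exists_mem_affineSet x).choose
  mem_chart_source x := (exists_mem_affineSet x).choose_spec
  chart_mem_atlas _ := ⟨_, rfl⟩

/-- `ℂP^m` is a smooth (real) manifold, modelled on `ℂ^m ≅ ℝ^(2m)`. -/
instance : IsManifold 𝓘(ℝ, Fin m → ℂ) ∞ (CP m) := by
  apply isManifold_of_contDiffOn
  rintro _ _ ⟨i, rfl⟩ ⟨j, rfl⟩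
  have hc : ∀ k, ContDiff ℝ ∞ fun z : Fin m → ℂ => (i.insertNth 1 z : Fin (m + 1) → ℂ) k := by
    intro k
    refine i.succAboveCases ?_ (fun l => ?_) k
    · simpa using contDiff_const
    · simpa using contDiff_apply ℝ ℂ l
  refine contDiffOn_pi.2 fun k => ?_
  refine ((hc (j.succAbove k)).contDiffOn.mul ((hc j).contDiffOn.inv ?_)).congr
    fun z _ => div_eq_mul_inv _ _
  rintro z ⟨hz, -⟩
  exact (mk_mem_affineSet j _).1 hz.2

end CP

/-! ### Isospectral Hermitian matrices -/

/-- `Her(ℂ^n)`: the real vector space of Hermitian `n × n` complex matrices. -/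
def Her (n : ℕ) : Type := selfAdjoint.submodule ℝ (Matrix (Fin n) (Fin n) ℂ)

namespace Her

attribute [local instance] Matrix.normedAddCommGroup Matrix.normedSpace

/-- A norm on `Her(ℂ^n)` (the maximum of the absolute values of the entries). Any other norm
defines the same topology and the same smooth structure, the space being finite-dimensional. -/
noncomputable instance (n : ℕ) : NormedAddCommGroup (Her n) :=
  inferInstanceAs (NormedAddCommGroup (selfAdjoint.submodule ℝ (Matrix (Fin n) (Fin n) ℂ)))

noncomputable instance (n : ℕ) : NormedSpace ℝ (Her n) :=
  inferInstanceAs (NormedSpace ℝ (selfAdjoint.submodule ℝ (Matrix (Fin n) (Fin n) ℂ)))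

/-- The underlying matrix. -/
def toMatrix {n : ℕ} (ρ : Her n) : Matrix (Fin n) (Fin n) ℂ := ρ.1

end Her

/-- `𝒟(σ)`: the Hermitian matrices with spectrum `σ = (p_1, …, p_n)`, that is, whose
eigenvalues, listed with multiplicity, are `p_1, …, p_n` in some order. -/
def isospectral {n : ℕ} (σ : Fin n → ℝ) : Set (Her n) :=
  {ρ | ρ.toMatrix.charpoly.roots = Finset.univ.val.map fun i => (σ i : ℂ)}

/-- The given `d`-dimensional charts make the subset `S` (with the subspace topology) of the
real normed space `E` an embedded smooth submanifold of `E`. -/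
structure IsEmbeddedSubmanifold {E : Type*} [NormedAddCommGroup E] [NormedSpace ℝ E] (S : Set E)
    (d : ℕ) [ChartedSpace (EuclideanSpace ℝ (Fin d)) S] : Prop where
  isManifold : IsManifold (𝓡 d) ∞ S
  isSmoothEmbedding : Manifold.IsSmoothEmbedding (𝓡 d) 𝓘(ℝ, E) ∞ (Subtype.val : S → E)

/-!
Put `a = p_1`, and let `b < a` be the common value of the other eigenvalues (any number `b < a` if
`n = 1`). A Hermitian matrix with spectrum `a, b, …, b` is determined by its `a`-eigenspace, which
is an arbitrary line. Hence `𝒟(σ)` is the image of the injective map `CP.toHer a b : [v] ↦ b • 1 + (a - b) / |v|² • v vᴴ` on `ℂP^(n-1)`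
(`CP.range_toHer`): the inclusion `⊆` is the spectral theorem (`Her.exists_eq_ofVector`), and `⊇` is
the characteristic polynomial of a rank one matrix (`Her.ofVector_mem_isospectral`).

This map is a smooth embedding (`CP.isSmoothEmbedding_toHer`). As `ℂP^(n-1)` is compact, only the
immersion property has to be shown. On the affine set `v_i ≠ 0` the coordinates `v_j / v_i` of `[v]`
are the quotients of the entries of the `i`-th column of the image by `ρ_ii - b`, so the map has an
explicit smooth left inverse there; subtracting from `ρ` the point of the image with the same
coordinates gives a chart of the space of Hermitian matrices in which the map is linear
(`sliceChart`). No inverse function theorem is involved.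

Finally, the image of any smooth embedding of a manifold `M` is an embedded submanifold
(`exists_isEmbeddedSubmanifold_range`), and every structure of embedded submanifold on it is
diffeomorphic to `M` (`nonempty_diffeomorph_of_isEmbeddedSubmanifold_range`).
-/

open Manifold

/-! ### Slice charts for maps with an explicit left inverse -/

section

variable {E H : Type*} [NormedAddCommGroup E] [NormedSpace ℝ E] [NormedAddCommGroup H]
  [NormedSpace ℝ H]

/-- Let `ι : E → H` be a linear section of `π`, let `ℓ` be a functional vanishing on the range of
`ι`, and write `Q = 1 - ι π` and `g ρ = (ℓ ρ - b)⁻¹ • π ρ`. For every `f : E → H` the map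
`ρ ↦ ι (g ρ) + Q (ρ - f (g ρ))` is a chart of `H` on `{ρ | ℓ ρ ≠ b}`. Its inverse at `τ` first finds
`z = g ρ` as `π τ`, then `Q ρ` as `Q (τ + f z)`, then the scalar `ℓ ρ - b` as `ℓ (Q ρ) - b`, and
finally `π ρ = (ℓ ρ - b) • z`.
If `π (f z) = (ℓ (f z) - b) • z`, so that `g` is a left inverse of `f`, then the chart carries `f z`
to `ι z`, see `sliceChart_apply`. -/
noncomputable def sliceChart (π : H →L[ℝ] E) (ι : E →L[ℝ] H) (ℓ : H →L[ℝ] ℝ) (b : ℝ)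
    (f : E → H) (hι : ∀ z, π (ι z) = z) (hℓ : ∀ z, ℓ (ι z) = 0) (hf : Continuous f) :
    OpenPartialHomeomorph H H where
  toFun ρ := ι ((ℓ ρ - b)⁻¹ • π ρ) +
    ((ρ - f ((ℓ ρ - b)⁻¹ • π ρ)) - ι (π (ρ - f ((ℓ ρ - b)⁻¹ • π ρ))))
  invFun τ := (τ + f (π τ) - ι (π (τ + f (π τ)))) + ι ((ℓ (τ + f (π τ)) - b) • π τ)
  source := {ρ | ℓ ρ ≠ b}
  target := {τ | ℓ (τ + f (π τ)) ≠ b}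
  map_source' ρ hρ := by
    simpa [hι, hℓ] using hρ
  map_target' τ hτ := by
    simpa [hι, hℓ] using hτ
  left_inv' ρ hρ := by
    have h : ℓ ρ - b ≠ 0 := sub_ne_zero.2 hρ
    simp [hι, hℓ, smul_smul, h]
    abel
  right_inv' τ hτ := by
    have h : ℓ τ + ℓ (f (π τ)) - b ≠ 0 := sub_ne_zero.2 (by simpa using hτ)
    simp [hι, hℓ, smul_smul, h]
    abel
  open_source := isOpen_ne_fun (by fun_prop) (by fun_prop)
  open_target := isOpen_ne_fun (by fun_prop) (by fun_prop)
  continuousOn_toFun := by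
    have h : ContinuousOn (fun ρ => (ℓ ρ - b)⁻¹) {ρ | ℓ ρ ≠ b} :=
      ContinuousOn.inv₀ (by fun_prop) fun ρ hρ => sub_ne_zero.2 hρ
    fun_prop
  continuousOn_invFun := by fun_prop

variable {π : H →L[ℝ] E} {ι : E →L[ℝ] H} {ℓ : H →L[ℝ] ℝ} {b : ℝ}
    {f : E → H} {hι : ∀ z, π (ι z) = z} {hℓ : ∀ z, ℓ (ι z) = 0}

theorem sliceChart_mem_maximalAtlas (hf : ContDiff ℝ ∞ f) :
    sliceChart π ι ℓ b f hι hℓ hf.continuous ∈ IsManifold.maximalAtlas 𝓘(ℝ, H) ∞ H := by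
  refine StructureGroupoid.mem_maximalAtlas_of_mem_groupoid _ ?_
  rw [contDiffGroupoid, mem_groupoid_of_pregroupoid, contDiffPregroupoid]
  constructor
  · have h : ContDiffOn ℝ ∞ (fun ρ => (ℓ ρ - b)⁻¹) {ρ | ℓ ρ ≠ b} :=
      ContDiffOn.inv (by fun_prop) fun ρ hρ => sub_ne_zero.2 hρ
    have : ContDiffOn ℝ ∞ (fun ρ => ι ((ℓ ρ - b)⁻¹ • π ρ) +
        ((ρ - f ((ℓ ρ - b)⁻¹ • π ρ)) - ι (π (ρ - f ((ℓ ρ - b)⁻¹ • π ρ))))) {ρ | ℓ ρ ≠ b} := by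
      fun_prop
    simpa [sliceChart] using this
  · have : ContDiff ℝ ∞ (fun τ => (τ + f (π τ) - ι (π (τ + f (π τ)))) +
      ι ((ℓ (τ + f (π τ)) - b) • π τ)) := by fun_prop
    simpa [sliceChart] using this.contDiffOn

/-- In its slice chart the map `f` is the linear inclusion `ι`. -/
theorem sliceChart_apply (hf : Continuous f) {z : E} (hz : ℓ (f z) ≠ b)
    (hz' : π (f z) = (ℓ (f z) - b) • z) : sliceChart π ι ℓ b f hι hℓ hf (f z) = ι z := by
  have h : ℓ (f z) - b ≠ 0 := sub_ne_zero.2 hz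
  simp [sliceChart, hz', smul_smul, h]

end

/-! ### Images of smooth embeddings -/

section

variable {E V : Type*} [NormedAddCommGroup E] [NormedSpace ℝ E] [NormedAddCommGroup V]
  [NormedSpace ℝ V] {M : Type*} [TopologicalSpace M] [ChartedSpace E M] {f : M → V}

/-- The image of a smooth embedding is an embedded submanifold. -/
theorem exists_isEmbeddedSubmanifold_range [FiniteDimensional ℝ E] [IsManifold 𝓘(ℝ, E) ∞ M]
    (hf : IsSmoothEmbedding 𝓘(ℝ, E) 𝓘(ℝ, V) ∞ f) :
    ∃ (d : ℕ) (_ : ChartedSpace (EuclideanSpace ℝ (Fin d)) (Set.range f)),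
      IsEmbeddedSubmanifold (Set.range f) d := by
  let e : E ≃L[ℝ] EuclideanSpace ℝ (Fin (Module.finrank ℝ E)) := toEuclidean
  let h : M ≃ₜ Set.range f := hf.isEmbedding.toHomeomorph
  -- The atlas on the image is transported from the maximal atlas of `M`, so that the charts in
  -- which `f` is linear belong to it.
  let T : OpenPartialHomeomorph M E →
      OpenPartialHomeomorph (Set.range f) (EuclideanSpace ℝ (Fin (Module.finrank ℝ E))) := fun c =>
    (h.symm.toOpenPartialHomeomorph.trans c).trans e.toHomeomorph.toOpenPartialHomeomorph
  let C : ChartedSpace (EuclideanSpace ℝ (Fin (Module.finrank ℝ E))) (Set.range f) :=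
    { atlas := T '' IsManifold.maximalAtlas 𝓘(ℝ, E) ∞ M
      chartAt x := T (chartAt E (h.symm x))
      mem_chart_source x := by simp [T]
      chart_mem_atlas x := ⟨_, IsManifold.chart_mem_maximalAtlas _, rfl⟩ }
  have hM : IsManifold (𝓡 (Module.finrank ℝ E)) ∞ (Set.range f) := by
    apply isManifold_of_contDiffOn
    rintro _ _ ⟨c, hc, rfl⟩ ⟨c', hc', rfl⟩
    have := (contDiffGroupoid ∞ 𝓘(ℝ, E)).compatible_of_mem_maximalAtlas hc hc'
    rw [contDiffGroupoid, mem_groupoid_of_pregroupoid, contDiffPregroupoid] at this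
    have h1 : ContDiffOn ℝ ∞ (c' ∘ c.symm) (c.target ∩ c.symm ⁻¹' c'.source) := by
      simpa [contDiffPregroupoid] using this.1
    have h2 : ContDiffOn ℝ ∞ (e ∘ (c' ∘ c.symm) ∘ e.symm)
        (e.symm ⁻¹' (c.target ∩ c.symm ⁻¹' c'.source)) :=
      e.contDiff.comp_contDiffOn (h1.comp e.symm.contDiff.contDiffOn fun _ hx => hx)
    refine (h2.congr ?_).mono ?_
    · intro x _
      simp [T]
    · intro x
      simp [T]
  refine ⟨_, C, hM, ?_, .subtypeVal⟩
  have hi := hf.isImmersion.isImmersionOfComplement_complement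
  refine IsImmersionOfComplement.isImmersion (F := hf.isImmersion.complement) fun x => ?_
  have hx := hi (h.symm x)
  have hfh : ∀ y, f (h.symm y) = y := fun y => congrArg Subtype.val (h.apply_symm_apply y)
  refine IsImmersionAtOfComplement.mk_of_charts
    ((e.symm.prodCongr (.refl ℝ _)).trans hx.equiv) (T hx.domChart) hx.codChart ?_ ?_
    (IsManifold.subset_maximalAtlas ⟨_, hx.domChart_mem_maximalAtlas, rfl⟩)
    hx.codChart_mem_maximalAtlas ?_ ?_
  · simpa [T] using hx.mem_domChart_source
  · simpa only [hfh] using hx.mem_codChart_source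
  · intro y hy
    have : h.symm y ∈ hx.domChart.source := by simpa [T] using hy
    simpa only [Set.mem_preimage, hfh] using hx.source_subset_preimage_source this
  · intro y hy
    have hy' : e.symm y ∈ (hx.domChart.extend 𝓘(ℝ, E)).target := by simpa [T] using hy
    simpa [T, h] using hx.writtenInCharts hy'

/-- The submanifold structure on the image of a smooth embedding is unique up to diffeomorphism: a
continuous map is smooth once its composition with an immersion is, and this applies to `f`
corestricted to its image (with the immersion `Subtype.val`) as well as to its inverse (with the
immersion `f`). -/
theorem nonempty_diffeomorph_of_isEmbeddedSubmanifold_range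
    (hf : IsSmoothEmbedding 𝓘(ℝ, E) 𝓘(ℝ, V) ∞ f) (d : ℕ)
    [ChartedSpace (EuclideanSpace ℝ (Fin d)) (Set.range f)]
    (hd : IsEmbeddedSubmanifold (Set.range f) d) :
    Nonempty (Set.range f ≃ₘ^∞⟮𝓡 d, 𝓘(ℝ, E)⟯ M) := by
  let h : M ≃ₜ Set.range f := hf.isEmbedding.toHomeomorph
  have hfh : f ∘ h.symm = Subtype.val :=
    funext fun y => congrArg Subtype.val (h.apply_symm_apply y)
  refine ⟨⟨h.symm.toEquiv, ?_, ?_⟩⟩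
  · refine (ContMDiff.iff_comp_isImmersion hf.isImmersion).2 ⟨h.symm.continuous, ?_⟩
    exact hfh ▸ hd.isSmoothEmbedding.contMDiff
  · exact (ContMDiff.iff_comp_isImmersion hd.isSmoothEmbedding.isImmersion).2
      ⟨h.continuous, hf.contMDiff⟩

end

/-! ### Hermitian matrices with one simple and one repeated eigenvalue -/

namespace Her

variable {n : ℕ}

instance : FiniteDimensional ℝ (Her n) :=
  inferInstanceAs (FiniteDimensional ℝ (selfAdjoint.submodule ℝ (Matrix (Fin n) (Fin n) ℂ)))

theorem isHermitian (ρ : Her n) : ρ.toMatrix.IsHermitian := ρ.2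

theorem toMatrix_injective : Function.Injective (toMatrix : Her n → _) := Subtype.val_injective

/-- A Hermitian matrix as an element of `Her n`. -/
def ofMatrix (A : Matrix (Fin n) (Fin n) ℂ) (hA : A.IsHermitian) : Her n := ⟨A, hA⟩

/-- The `(j, k)` entry, as a continuous real-linear map. -/
noncomputable def entry (j k : Fin n) : Her n →L[ℝ] ℂ :=
  LinearMap.toContinuousLinearMap
    { toFun ρ := ρ.toMatrix j k
      map_add' _ _ := rfl
      map_smul' _ _ := rfl }

@[simp] theorem entry_apply (j k : Fin n) (ρ : Her n) : entry j k ρ = ρ.toMatrix j k := rfl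

/-- The Hermitian part `(A + Aᴴ) / 2`. The domain is a plain function space, since matrices carry no
global topology coming from a norm. -/
noncomputable def hermitianPart : (Fin n → Fin n → ℂ) →L[ℝ] Her n :=
  LinearMap.toContinuousLinearMap
    { toFun A := ofMatrix ((1 / 2 : ℝ) • (Matrix.of A + (Matrix.of A).conjTranspose))
        (by
          rw [Matrix.IsHermitian, Matrix.conjTranspose_smul, Matrix.conjTranspose_add,
            Matrix.conjTranspose_conjTranspose, add_comm]
          simp)
      map_add' A B := toMatrix_injective (by
        change (1 / 2 : ℝ) • (Matrix.of (A + B) + (Matrix.of (A + B)).conjTranspose) =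
          (1 / 2 : ℝ) • (Matrix.of A + (Matrix.of A).conjTranspose) +
          (1 / 2 : ℝ) • (Matrix.of B + (Matrix.of B).conjTranspose)
        ext j k
        simp
        ring)
      map_smul' t A := toMatrix_injective (by
        change (1 / 2 : ℝ) • (Matrix.of (t • A) + (Matrix.of (t • A)).conjTranspose) =
          t • (1 / 2 : ℝ) • (Matrix.of A + (Matrix.of A).conjTranspose)
        ext j k
        simp
        ring) }

theorem toMatrix_hermitianPart (A : Fin n → Fin n → ℂ) :
    (hermitianPart A).toMatrix = (1 / 2 : ℝ) • (Matrix.of A + (Matrix.of A).conjTranspose) := rfl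

theorem hermitianPart_entry (ρ : Her n) : hermitianPart (fun j k => entry j k ρ) = ρ := by
  refine toMatrix_injective ?_
  change (1 / 2 : ℝ) • (ρ.toMatrix + ρ.toMatrix.conjTranspose) = ρ.toMatrix
  rw [ρ.isHermitian, ← two_smul ℝ, smul_smul]
  norm_num

/-- Smoothness of a map to `Her n` can be checked on matrix entries, because the Hermitian part
retracts all matrices onto the Hermitian ones. -/
theorem contDiff_of_entry {E : Type*} [NormedAddCommGroup E] [NormedSpace ℝ E] {f : E → Her n}
    (hf : ∀ j k, ContDiff ℝ ∞ fun x => (f x).toMatrix j k) : ContDiff ℝ ∞ f := by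
  have : f = fun x => hermitianPart fun j k => entry j k (f x) :=
    funext fun x => (hermitianPart_entry _).symm
  rw [this]
  exact hermitianPart.contDiff.comp (contDiff_pi.2 fun j => contDiff_pi.2 fun k => hf j k)

/-- The matrix `b • 1 + (a - b) / |v|² • v vᴴ`, where `|v|` is the Hermitian norm of `v`. For
`v ≠ 0` it is the Hermitian matrix with eigenvalue `a` on the line `ℂ v` and `b` on its orthogonal
complement; for `v = 0` the division by zero makes it `b • 1`. -/
noncomputable def ofVector (a b : ℝ) (v : Fin n → ℂ) : Her n :=
  ofMatrix (Matrix.scalar (Fin n) (b : ℂ) +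
      (((a - b) / ∑ l, Complex.normSq (v l) : ℝ) : ℂ) • Matrix.vecMulVec v (star v)) (by
    ext j k
    simp [Matrix.vecMulVec_apply, Matrix.diagonal_apply, eq_comm (a := j), apply_ite, mul_comm])

theorem toMatrix_ofVector (a b : ℝ) (v : Fin n → ℂ) :
    (ofVector a b v).toMatrix = Matrix.scalar (Fin n) (b : ℂ) +
      (((a - b) / ∑ l, Complex.normSq (v l) : ℝ) : ℂ) • Matrix.vecMulVec v (star v) := rfl

theorem ofVector_apply (a b : ℝ) (v : Fin n → ℂ) (j k : Fin n) :
    (ofVector a b v).toMatrix j k = (if j = k then (b : ℂ) else 0) +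
      (((a - b) / ∑ l, Complex.normSq (v l) : ℝ) : ℂ) * (v j * star (v k)) := by
  simp [toMatrix_ofVector, Matrix.vecMulVec_apply, Matrix.diagonal_apply]

theorem sum_normSq_pos {v : Fin n → ℂ} (hv : v ≠ 0) : 0 < ∑ l, Complex.normSq (v l) := by
  obtain ⟨i, hi⟩ := Function.ne_iff.1 hv
  exact Finset.sum_pos' (fun _ _ => Complex.normSq_nonneg _)
    ⟨i, Finset.mem_univ i, Complex.normSq_pos.2 hi⟩

theorem ofVector_smul (a b : ℝ) (v : Fin n → ℂ) {t : ℂ} (ht : t ≠ 0) :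
    ofVector a b (t • v) = ofVector a b v := by
  refine toMatrix_injective (Matrix.ext fun j k => ?_)
  have ht' : (Complex.normSq t : ℂ) ≠ 0 := by simpa using ht
  rw [ofVector_apply, ofVector_apply]
  congr 1
  simp only [Pi.smul_apply, smul_eq_mul, Complex.normSq_mul, ← Finset.mul_sum]
  have : t * v j * star (t * v k) = (Complex.normSq t : ℂ) * (v j * star (v k)) := by
    rw [Complex.normSq_eq_conj_mul_self]
    simp
    ring
  rw [this]
  push_cast
  by_cases h : (∑ l, (Complex.normSq (v l) : ℂ)) = 0
  · simp [h]
  · field_simp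

theorem map_ofReal_eq_cons_replicate {m : ℕ} {a b : ℝ} {σ : Fin (m + 1) → ℝ} (h0 : σ 0 = a)
    (h : ∀ i, i ≠ 0 → σ i = b) :
    (Finset.univ.val.map fun i => (σ i : ℂ)) = (a : ℂ) ::ₘ Multiset.replicate m (b : ℂ) := by
  have : (fun i : Fin m => (σ i.succ : ℂ)) = fun _ => (b : ℂ) :=
    funext fun i => by rw [h _ i.succ_ne_zero]
  rw [Fin.univ_val_map, List.ofFn_succ, h0, this, List.ofFn_const, ← Multiset.cons_coe,
    Multiset.coe_replicate]

theorem ofVector_mem_isospectral {m : ℕ} {a b : ℝ} {σ : Fin (m + 1) → ℝ} (h0 : σ 0 = a)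
    (h : ∀ i, i ≠ 0 → σ i = b) {v : Fin (m + 1) → ℂ} (hv : v ≠ 0) :
    ofVector a b v ∈ isospectral σ := by
  open Polynomial in
  have hN := (sum_normSq_pos hv).ne'
  have hdot : v ⬝ᵥ star v = ((∑ l, Complex.normSq (v l) : ℝ) : ℂ) := by
    simp [dotProduct, Complex.mul_conj]
  have hchar : (ofVector a b v).toMatrix.charpoly = (X - C (a : ℂ)) * (X - C (b : ℂ)) ^ m := by
    rw [toMatrix_ofVector, add_comm (Matrix.scalar _ _), ← sub_neg_eq_add _ (Matrix.scalar _ _),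
      ← map_neg, Matrix.charpoly_sub_scalar, ← Matrix.smul_vecMulVec, Matrix.charpoly_vecMulVec,
      smul_dotProduct, hdot, smul_eq_mul, ← Complex.ofReal_mul, div_mul_cancel₀ _ hN]
    simp [smul_eq_C_mul]
    ring
  have h1 : (X - C (a : ℂ)) * (X - C (b : ℂ)) ^ m ≠ 0 :=
    mul_ne_zero (X_sub_C_ne_zero _) (pow_ne_zero _ (X_sub_C_ne_zero _))
  change (ofVector a b v).toMatrix.charpoly.roots = _
  rw [hchar, roots_mul h1, roots_X_sub_C, roots_pow, roots_X_sub_C, Multiset.nsmul_singleton,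
    map_ofReal_eq_cons_replicate h0 h, Multiset.singleton_add]

/-- If the spectrum of a Hermitian matrix is `a, b, …, b`, then the spectral theorem writes the
matrix as `b • 1 + (a - b) • v vᴴ`, where `v` is a unit eigenvector for the eigenvalue `a`. -/
theorem exists_eq_ofVector {m : ℕ} {a b : ℝ} {σ : Fin (m + 1) → ℝ} (h0 : σ 0 = a)
    (h : ∀ i, i ≠ 0 → σ i = b) {ρ : Her (m + 1)} (hρ : ρ ∈ isospectral σ) :
    ∃ v, v ≠ 0 ∧ ofVector a b v = ρ := by
  have hA := ρ.isHermitian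
  have hσ : Finset.univ.val.map (fun i => (hA.eigenvalues i : ℂ)) =
      (a : ℂ) ::ₘ Multiset.replicate m (b : ℂ) :=
    (hA.roots_charpoly_eq_eigenvalues.symm.trans hρ).trans (map_ofReal_eq_cons_replicate h0 h)
  obtain ⟨i, -, hi⟩ := Multiset.mem_map.1 (hσ ▸ Multiset.mem_cons_self (a : ℂ) _)
  have hne : ∀ l, l ≠ i → (hA.eigenvalues l : ℂ) = b := by
    rw [← Multiset.cons_erase (Finset.mem_univ_val i), Multiset.map_cons, hi,
      Multiset.cons_inj_right] at hσ
    intro l hl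
    refine Multiset.eq_of_mem_replicate (n := m) (hσ ▸ Multiset.mem_map_of_mem _ ?_)
    exact (Multiset.mem_erase_of_ne hl).2 (Finset.mem_univ_val l)
  let U : Matrix (Fin (m + 1)) (Fin (m + 1)) ℂ := hA.eigenvectorUnitary
  have hU : U * star U = 1 := Unitary.coe_mul_star_self _
  have hU' : star U * U = 1 := Unitary.coe_star_mul_self _
  have hdiag : Matrix.diagonal (RCLike.ofReal ∘ hA.eigenvalues) =
      Matrix.scalar (Fin (m + 1)) (b : ℂ) + ((a - b : ℝ) : ℂ) • Matrix.single i i 1 := by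
    ext j k
    rcases eq_or_ne j k with rfl | hjk
    · rcases eq_or_ne j i with rfl | hj
      · simp [hi]
      · simp [hne j hj, Matrix.single_apply_of_ne, hj.symm]
    · have : ¬ (i = j ∧ i = k) := fun h => hjk (h.1.symm.trans h.2)
      simp [hjk, Matrix.single_apply_of_ne, this]
  have hN : ∑ l, Complex.normSq (U l i) = 1 := by
    have := congrFun (congrFun hU' i) i
    rw [Matrix.mul_apply, Matrix.one_apply_eq] at this
    rw [← Complex.ofReal_inj, ← this.trans Complex.ofReal_one.symm]
    simp [Complex.normSq_eq_conj_mul_self]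
  refine ⟨fun l => U l i, fun h => ?_, toMatrix_injective ?_⟩
  · simp [fun l => show U l i = 0 from congrFun h l] at hN
  · have hρ' := hA.spectral_theorem
    rw [Unitary.conjStarAlgAut_apply, hdiag] at hρ'
    change ρ.toMatrix = U * _ * star U at hρ'
    rw [toMatrix_ofVector, hρ', mul_add, add_mul,
      ← (Matrix.scalar_commute (b : ℂ) (fun _ => mul_comm _ _) U).eq,
      mul_assoc, hU, mul_one, hN, div_one, mul_smul_comm, smul_mul_assoc]
    congr 2
    ext j k
    simp [Matrix.vecMulVec_apply, Matrix.mul_apply, Matrix.single_apply, ite_and]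

end Her

/-! ### The embedding of projective space -/

namespace CP

variable {m : ℕ}

/-- The map `[v] ↦ b • 1 + (a - b) / |v|² • v vᴴ`, sending a line `L` to the Hermitian matrix with
eigenvalue `a` on `L` and `b` on its orthogonal complement. -/
noncomputable def toHer (a b : ℝ) : CP m → Her (m + 1) :=
  Projectivization.lift (fun v : {v : Fin (m + 1) → ℂ // v ≠ 0} => Her.ofVector a b v.1) (by
    rintro v w t h
    have ht : t ≠ 0 := by
      rintro rfl
      exact v.2 (by simpa using h)
    simp only [h, Her.ofVector_smul a b w.1 ht])

theorem toHer_mk (a b : ℝ) (v : {v : Fin (m + 1) → ℂ // v ≠ 0}) :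
    toHer a b (mk v) = Her.ofVector a b v.1 := rfl

theorem range_toHer {a b : ℝ} {σ : Fin (m + 1) → ℝ} (h0 : σ 0 = a) (h : ∀ i, i ≠ 0 → σ i = b) :
    Set.range (toHer (m := m) a b) = isospectral σ := by
  ext ρ
  constructor
  · rintro ⟨x, rfl⟩
    obtain ⟨v, rfl⟩ := isQuotientMap_mk.surjective x
    exact Her.ofVector_mem_isospectral h0 h v.2
  · intro hρ
    obtain ⟨v, hv, rfl⟩ := Her.exists_eq_ofVector h0 h hρ
    exact ⟨mk ⟨v, hv⟩, rfl⟩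

/-- `ℂP^m` is the image of the unit sphere (here that of the sup norm). -/
instance : CompactSpace (CP m) := by
  let f : Metric.sphere (0 : Fin (m + 1) → ℂ) 1 → CP m := fun v =>
    mk ⟨v.1, fun h => by simpa [h] using v.2⟩
  have hf : Continuous f := isQuotientMap_mk.continuous.comp (by fun_prop)
  have hs : Function.Surjective f := fun x => by
    obtain ⟨v, rfl⟩ := isQuotientMap_mk.surjective x
    have hv : ‖v.1‖ ≠ 0 := norm_ne_zero_iff.2 v.2
    refine ⟨⟨((‖v.1‖⁻¹ : ℝ) : ℂ) • v.1, by simp [norm_smul, hv]⟩, ?_⟩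
    exact (Projectivization.mk_eq_mk_iff' ℂ _ _ _ v.2).2 ⟨_, rfl⟩
  exact hs.compactSpace hf

theorem toHer_mk_entry_self (a b : ℝ) (v : {v : Fin (m + 1) → ℂ // v ≠ 0}) (i : Fin (m + 1)) :
    ((toHer a b (mk v)).toMatrix i i).re =
      b + (a - b) / (∑ l, Complex.normSq (v.1 l)) * Complex.normSq (v.1 i) := by
  rw [toHer_mk, Her.ofVector_apply, if_pos rfl, Complex.star_def, Complex.mul_conj]
  simp only [← Complex.ofReal_mul, ← Complex.ofReal_add, Complex.ofReal_re]

theorem toHer_entry_self_ne_iff {a b : ℝ} (hab : b < a) (i : Fin (m + 1)) (x : CP m) :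
    ((toHer a b x).toMatrix i i).re ≠ b ↔ x ∈ affineSet i := by
  obtain ⟨v, rfl⟩ := isQuotientMap_mk.surjective x
  have hc : (a - b) / (∑ l, Complex.normSq (v.1 l)) ≠ 0 :=
    div_ne_zero (sub_ne_zero.2 hab.ne') (Her.sum_normSq_pos v.2).ne'
  rw [mk_mem_affineSet, toHer_mk_entry_self]
  simp [hc]

/-- The affine coordinates `v_j / v_i` of `[v]` can be read off the `i`-th column of its image,
whose entries off the diagonal are proportional to `v_j * star v_i`. -/
theorem toHer_entry (a b : ℝ) (i : Fin (m + 1)) (x : CP m) (j : Fin m) :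
    (toHer a b x).toMatrix (i.succAbove j) i =
      (((toHer a b x).toMatrix i i).re - b : ℝ) * toAffine i x j := by
  obtain ⟨v, rfl⟩ := isQuotientMap_mk.surjective x
  rw [toHer_mk_entry_self, toHer_mk, Her.ofVector_apply, if_neg (i.succAbove_ne j)]
  change _ = _ * (v.1 (i.succAbove j) / v.1 i)
  rcases eq_or_ne (v.1 i) 0 with h | h
  · simp [h]
  · simp only [add_sub_cancel_left, Complex.ofReal_mul, Complex.normSq_eq_conj_mul_self]
    field_simp
    simp

theorem toHer_injective {a b : ℝ} (hab : b < a) : Function.Injective (toHer (m := m) a b) := by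
  intro x y h
  obtain ⟨i, hi⟩ := exists_mem_affineSet x
  have hi' : y ∈ affineSet i := by
    rwa [← toHer_entry_self_ne_iff hab, ← h, toHer_entry_self_ne_iff hab]
  refine (affineChart i).injOn hi hi' (funext fun j => ?_)
  have hx := toHer_entry a b i x j
  rw [h, toHer_entry a b i y j] at hx
  have hne := sub_ne_zero.2 ((toHer_entry_self_ne_iff hab i y).2 hi')
  exact (mul_left_cancel₀ (Complex.ofReal_ne_zero.2 hne) hx).symm

/-- The off-diagonal part of the `i`-th column. -/
noncomputable def column (i : Fin (m + 1)) : Her (m + 1) →L[ℝ] (Fin m → ℂ) :=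
  ContinuousLinearMap.pi fun j => Her.entry (i.succAbove j) i

/-- The `i`-th diagonal entry, which is real. -/
noncomputable def diagEntry (i : Fin (m + 1)) : Her (m + 1) →L[ℝ] ℝ :=
  Complex.reCLM.comp (Her.entry i i)

/-- The Hermitian matrix with off-diagonal part `z` of the `i`-th column, the conjugate entries in
the `i`-th row, and zeros elsewhere. -/
noncomputable def ofColumn (i : Fin (m + 1)) : (Fin m → ℂ) →L[ℝ] Her (m + 1) :=
  -- The factor `2` cancels the `1 / 2` in the Hermitian part.
  Her.hermitianPart.comp (ContinuousLinearMap.pi fun j => ContinuousLinearMap.pi fun k =>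
    if k = i then (2 : ℝ) • i.insertNth (α := fun _ => (Fin m → ℂ) →L[ℝ] ℂ) 0
      (fun l => ContinuousLinearMap.proj l) j else 0)

theorem column_ofColumn (i : Fin (m + 1)) (z : Fin m → ℂ) : column i (ofColumn i z) = z := by
  ext j
  simp [column, ofColumn, Her.toMatrix_hermitianPart]

theorem diagEntry_ofColumn (i : Fin (m + 1)) (z : Fin m → ℂ) : diagEntry i (ofColumn i z) = 0 := by
  simp [diagEntry, ofColumn, Her.toMatrix_hermitianPart]

theorem contDiff_toHer_ofAffine (a b : ℝ) (i : Fin (m + 1)) :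
    ContDiff ℝ ∞ fun z => toHer a b (ofAffine i z) := by
  have hc : ∀ k, ContDiff ℝ ∞ fun z : Fin m → ℂ => (i.insertNth 1 z : Fin (m + 1) → ℂ) k := by
    intro k
    refine i.succAboveCases ?_ (fun l => ?_) k
    · simpa using contDiff_const
    · simpa using contDiff_apply ℝ ℂ l
  have hne : ∀ z : Fin m → ℂ, (i.insertNth 1 z : Fin (m + 1) → ℂ) ≠ 0 := fun z h =>
    one_ne_zero (α := ℂ) (by simpa using congrFun h i)
  refine Her.contDiff_of_entry fun j k => ?_
  change ContDiff ℝ ∞ fun z => (Her.ofVector a b (i.insertNth 1 z)).toMatrix j k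
  simp only [Her.ofVector_apply]
  refine contDiff_const.add (ContDiff.mul ?_ ((hc j).mul (Complex.conjCLE.contDiff.comp (hc k))))
  refine Complex.ofRealCLM.contDiff.comp (contDiff_const.div (ContDiff.sum fun l _ => ?_)
    fun z => (Her.sum_normSq_pos (hne z)).ne')
  simp only [Complex.normSq_apply]
  have hre := Complex.reCLM.contDiff.comp (hc l)
  have him := Complex.imCLM.contDiff.comp (hc l)
  exact (hre.mul hre).add (him.mul him)

/-- The splitting of `Her(ℂ^(m+1))` into the `i`-th column off the diagonal and the matrices for
which it vanishes. -/
noncomputable def columnEquiv (i : Fin (m + 1)) :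
    ((Fin m → ℂ) × (column i).ker) ≃L[ℝ] Her (m + 1) :=
  (ContinuousLinearEquiv.equivOfRightInverse (column i) (ofColumn i) (column_ofColumn i)).symm

theorem isImmersionAtOfComplement_toHer {a b : ℝ} (hab : b < a) (i : Fin (m + 1)) {x : CP m}
    (hx : x ∈ affineSet i) :
    IsImmersionAtOfComplement (column i).ker 𝓘(ℝ, Fin m → ℂ) 𝓘(ℝ, Her (m + 1)) ∞ (toHer a b) x := by
  have hs : ∀ y ∈ affineSet i, diagEntry i (toHer a b y) ≠ b := fun y =>
    (toHer_entry_self_ne_iff hab i y).2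
  have hf := contDiff_toHer_ofAffine a b i
  refine IsImmersionAtOfComplement.mk_of_charts (columnEquiv i) (affineChart i)
    (sliceChart (column i) (ofColumn i) (diagEntry i) b _ (column_ofColumn i)
      (diagEntry_ofColumn i) hf.continuous) hx (hs x hx)
    (IsManifold.subset_maximalAtlas ⟨i, rfl⟩) (sliceChart_mem_maximalAtlas hf) hs ?_
  intro z _
  have hz : ofAffine i z ∈ affineSet i := (affineChart i).map_target (Set.mem_univ z)
  have hz' : toAffine i (ofAffine i z) = z := (affineChart i).right_inv (Set.mem_univ z)
  have h := sliceChart_apply (hι := column_ofColumn i) (hℓ := diagEntry_ofColumn i)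
    hf.continuous (hs _ hz) (funext fun j =>
      (toHer_entry a b i (ofAffine i z) j).trans (by
        rw [hz', Pi.smul_apply, Complex.real_smul]
        rfl))
  have hι : columnEquiv i (z, 0) = ofColumn i z := by simp [columnEquiv]
  exact h.trans hι.symm

theorem isSmoothEmbedding_toHer {a b : ℝ} (hab : b < a) :
    IsSmoothEmbedding 𝓘(ℝ, Fin m → ℂ) 𝓘(ℝ, Her (m + 1)) ∞ (toHer (m := m) a b) := by
  have hi : IsImmersionOfComplement (column (0 : Fin (m + 1))).ker 𝓘(ℝ, Fin m → ℂ)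
      𝓘(ℝ, Her (m + 1)) ∞ (toHer (m := m) a b) := fun x => by
    obtain ⟨i, hx⟩ := exists_mem_affineSet x
    -- The complements obtained from the various affine charts have the same dimension, so that of
    -- the chart with index `0` serves for all of them.
    refine (isImmersionAtOfComplement_toHer hab i hx).trans_F
      (ContinuousLinearEquiv.ofFinrankEq ?_)
    have h := (columnEquiv i).toLinearEquiv.finrank_eq.trans
      (columnEquiv 0).toLinearEquiv.finrank_eq.symm
    simpa [Module.finrank_prod] using h
  exact ⟨hi.isImmersion,
    (hi.contMDiff.continuous.isClosedEmbedding (toHer_injective hab)).isEmbedding⟩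

end CP

/-! ### Isospectral matrices and projective space -/

theorem mainTheorem2 (n : ℕ) [NeZero n] (σ : Fin n → ℝ)
    (hgt : ∀ i, i ≠ 0 → σ i < σ 0)
    (heq : ∀ i j, i ≠ 0 → j ≠ 0 → σ i = σ j) :
    (∃ (d : ℕ) (_ : ChartedSpace (EuclideanSpace ℝ (Fin d)) (isospectral σ)),
      IsEmbeddedSubmanifold (isospectral σ) d) ∧
    ∀ (d : ℕ) [ChartedSpace (EuclideanSpace ℝ (Fin d)) (isospectral σ)],
      IsEmbeddedSubmanifold (isospectral σ) d →
      Nonempty (isospectral σ ≃ₘ^∞⟮𝓡 d, 𝓘(ℝ, Fin (n - 1) → ℂ)⟯ CP (n - 1)) := by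
  obtain ⟨m, rfl⟩ := Nat.exists_eq_succ_of_ne_zero (NeZero.ne n)
  obtain ⟨b, hb, h⟩ : ∃ b, b < σ 0 ∧ ∀ i, i ≠ 0 → σ i = b := by
    by_cases hi : ∃ i : Fin (m + 1), i ≠ 0
    · obtain ⟨i, hi⟩ := hi
      exact ⟨σ i, hgt i hi, fun j hj => heq j i hj hi⟩
    -- For `n = 1` there is no second eigenvalue, and any number below `σ 0` takes its place.
    · exact ⟨σ 0 - 1, by linarith, fun i h => (hi ⟨i, h⟩).elim⟩
  rw [← CP.range_toHer rfl h]
  have he := CP.isSmoothEmbedding_toHer (m := m) hb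
  exact ⟨exists_isEmbeddedSubmanifold_range he, fun d _ hd =>
    nonempty_diffeomorph_of_isEmbeddedSubmanifold_range he d hd⟩
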